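/- Let $n$ and $b$ be positive integers and let $P=\mathrm{conv}\{x\in\{0,1\}^n : \sum_{i=1}^n 2^{i-1}x_i\le b\}$ be the 0-1 knapsack polytope with coefficients $2^{i-1}$ and right-hand side $b$. If $b\le 2^n-1$, write $b=\sum_{k=1}^n 2^{k-1}\bar x_k$ with $\bar x\in\{0,1\}^n$ and let $J=\{j\in\{1,\dots,n\}:\bar x_j=0\}$; if $b> 2^n-1$, let $J=\emptyset$. For $j\in J$ let $a_j\in\{0,1\}^n$ be given by $a_{jk}=0$ for $k<j$, $a_{jj}=1$, and $a_{jk}=\bar x_k$ for $k>j$, and let $b_j=\sum_{k=1}^n a_{jk}-1$. Then: (1) $P=\{x\in[0,1]^n : a_j^Tx\le b_j \text{ for all } j\in J\}$. Each inequality $a_j^Tx\le b_j$ is a cover inequality of the knapsack, i.e. it has the form $\sum_{k\in C}x_k\le |C|-1$ for some $C\subseteq\{1,\dots,n\}$ with $\sum_{k\in C}2^{k-1}>b$; and there are at most $n-1$ of them, $|J|\le n-1$. The list of these inequalities can be computed by a Turing machine in time polynomial in $n+\log_2(b+1)$ (on input $n$ in unary and $b$ in binary). (2) Let $u$ be a positive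 integer, $q=\lceil\log_2(u+1)\rceil$, $B^{L}(u)=\{(x,z)\in[0,u]\times[0,1]^q : x=\sum_{j=1}^q 2^{j-1}z_j\}$ and $B^{L^+}(u)=\mathrm{conv}\big(B^{L}(u)\cap(\mathbb R\times\{0,1\}^q)\big)$. Then $B^{L^+}(u)$ is described by the single equation $x=\sum_{j=1}^q2^{j-1}z_j$, the bounds $0\le z\le 1$, and at most $q-1$ further inequalities, namely the inequalities of (1) in the variables $z$ for $n=q$ and $b=u$. The list of these inequalities can be computed by a Turing machine in time polynomial in the length of the binary encoding of $u$. -/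

import Mathlib

open Computability

/-- A linear inequality `c₀ x₀ + c₁ x₁ + ⋯ ≤ d` with nonnegative integer data; `coeff` lists the
coefficients `c₀, c₁, …` in order and `rhs` is `d`. -/
@[ext] structure NatIneq where
  coeff : List ℕ
  rhs : ℕ

/-- The point `x` satisfies the inequality. -/
def NatIneq.HoldsAt (r : NatIneq) {n : ℕ} (x : Fin n → ℝ) : Prop :=
  ∑ k : Fin n, (r.coeff.getD (k : ℕ) 0 : ℝ) * x k ≤ (r.rhs : ℝ)

/-- The 0-1 knapsack polytope with weights `1, 2, 4, …, 2 ^ (n - 1)` and capacity `b`. (The indices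
are `0, …, n - 1`, so the weight of index `i` is `2 ^ i`.) -/
def knapsackPolytope (n b : ℕ) : Set (Fin n → ℝ) :=
  convexHull ℝ {x | (∀ i, x i = 0 ∨ x i = 1) ∧ ∑ i : Fin n, (2 : ℝ) ^ (i : ℕ) * x i ≤ (b : ℝ)}

/-- `r` is a cover inequality of this knapsack: for some cover `C`, that is, a set of indices with
total weight greater than `b`, it reads `∑ k ∈ C, x k ≤ |C| - 1`. -/
def IsCoverIneq (n b : ℕ) (r : NatIneq) : Prop :=
  ∃ C : Finset (Fin n), b < ∑ k ∈ C, 2 ^ (k : ℕ) ∧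
    r.coeff = List.ofFn (fun k : Fin n => if k ∈ C then 1 else 0) ∧ r.rhs + 1 = C.card

/-- The coefficient of `x k` in the inequality attached to the index `j`: it is `0` for `k < j`,
`1` for `k = j`, and the `k`-th binary digit of `b` for `k > j`. -/
def coverCoeff (b j k : ℕ) : ℕ :=
  if k < j then 0 else if k = j then 1 else (b.testBit k).toNat

/-- The inequality attached to the index `j < n`: its right-hand side is the sum of its
coefficients (which is at least `1`) minus one. -/
def coverIneq (n b j : ℕ) : NatIneq where
  coeff := (List.range n).map (coverCoeff b j)
  rhs := (∑ k ∈ Finset.range n, coverCoeff b j k) - 1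

/-- The explicit system: one inequality for each index `j < n` at which the binary digit of `b` is
`0`, in increasing order of `j`; no inequality at all if `b > 2 ^ n - 1`. -/
def coverSystem (n b : ℕ) : List NatIneq :=
  if 2 ^ n ≤ b then []
  else ((List.range n).filter (fun j => !b.testBit j)).map (coverIneq n b)

/-- The number `⌈log₂ (u + 1)⌉` of binary variables. -/
def logDim (u : ℕ) : ℕ := Nat.clog 2 (u + 1)

/-- The logarithmic binarization polytope of an integer variable `x ∈ {0, …, u}`: the points
`(x, z)` with `0 ≤ x ≤ u`, `z ∈ [0, 1] ^ q` and `x = ∑ j, 2 ^ j z j`. -/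
def logBinarization (u : ℕ) : Set (ℝ × (Fin (logDim u) → ℝ)) :=
  {p | (0 ≤ p.1 ∧ p.1 ≤ (u : ℝ)) ∧ (∀ j, 0 ≤ p.2 j ∧ p.2 j ≤ 1) ∧
    p.1 = ∑ j : Fin (logDim u), (2 : ℝ) ^ (j : ℕ) * p.2 j}

/-- The perfect logarithmic binarization: the convex hull of the points of the logarithmic
binarization polytope whose `z` is a 0-1 vector. -/
def perfectLogBinarization (u : ℕ) : Set (ℝ × (Fin (logDim u) → ℝ)) :=
  convexHull ℝ (logBinarization u ∩ {p | ∀ j, p.2 j = 0 ∨ p.2 j = 1})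

namespace NatIneq

/-- An inequality as a word: the coefficients in binary, each followed by a comma, then the
right-hand side in binary, then a closing bracket. -/
def toWord (r : NatIneq) : List Γ' :=
  r.coeff.flatMap (fun c => (encodeNat c).map Γ'.bit ++ [Γ'.comma]) ++
    ((encodeNat r.rhs).map Γ'.bit ++ [Γ'.ket])

/-- One step of a parser that reads a word from right to left; it keeps, for each inequality read
so far, the list of its numbers in binary. -/
def parseStep : Γ' → List (List (List Bool)) → List (List (List Bool))
  | Γ'.ket, rows => [[]] :: rows
  | Γ'.comma, r :: rows => ([] :: r) :: rows
  | Γ'.bit b, (w :: r) :: rows => ((b :: w) :: r) :: rows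
  | _, rows => rows

/-- The inequality whose numbers, the right-hand side last, are given in binary. -/
def ofBits (r : List (List Bool)) : NatIneq where
  coeff := r.dropLast.map decodeNat
  rhs := decodeNat (r.getLastD [])

theorem foldr_bits (l w : List Bool) (r : List (List Bool)) (rows : List (List (List Bool))) :
    (l.map Γ'.bit).foldr parseStep ((w :: r) :: rows) = ((l ++ w) :: r) :: rows := by
  induction l with
  | nil => rfl
  | cons b l ih => simp [ih, parseStep]

theorem foldr_coeff (cs : List ℕ) (r : List (List Bool)) (rows : List (List (List Bool))) :
    (cs.flatMap (fun c => (encodeNat c).map Γ'.bit ++ [Γ'.comma])).foldr parseStep (r :: rows) =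
      (cs.map encodeNat ++ r) :: rows := by
  induction cs with
  | nil => rfl
  | cons c cs ih =>
    rw [List.flatMap_cons, List.foldr_append, ih, List.foldr_append]
    simp [parseStep, foldr_bits]

theorem foldr_toWord (r : NatIneq) (rows : List (List (List Bool))) :
    r.toWord.foldr parseStep rows = (r.coeff.map encodeNat ++ [encodeNat r.rhs]) :: rows := by
  have h : ((encodeNat r.rhs).map Γ'.bit ++ [Γ'.ket]).foldr parseStep rows =
      [encodeNat r.rhs] :: rows := by
    simp [parseStep, foldr_bits]
  rw [toWord, List.foldr_append, h, foldr_coeff]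

theorem ofBits_encode (r : NatIneq) :
    ofBits (r.coeff.map encodeNat ++ [encodeNat r.rhs]) = r := by
  ext1 <;> simp [ofBits, Function.comp_def]

/-- The encoding of finite systems of inequalities: the words of the inequalities, one after the
other, with all numbers written in binary. -/
def encodingSystem : Encoding (List NatIneq) Γ' where
  encode S := S.flatMap toWord
  decode w := some ((w.foldr parseStep []).map ofBits)
  decode_encode S := by
    congr 1
    induction S with
    | nil => rfl
    | cons r S ih => rw [List.flatMap_cons, List.foldr_append, foldr_toWord, List.map_cons, ih,
        ofBits_encode]

end NatIneq

/-- The encoding of a knapsack instance `(n, b)`: `n` marks, one for each of the weights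
`1, 2, …, 2 ^ (n - 1)`, followed by `b` in binary. Its length is `n` plus the number of binary
digits of `b`, which is at most the length of the list of all weights and `b` in binary. -/
def encodingInstance : Encoding (ℕ × ℕ) (Bool ⊕ Bool) :=
  encodingProd unaryEncodingNat encodingNatBool

/-- `f` is computable in polynomial time by a (multi-stack) Turing machine, where inputs and outputs
are written in the given encodings and the time is measured in the length of the encoded input. -/
def IsPolyTime {α β Γ₁ Γ₂ : Type} (ea : Encoding α Γ₁) (eb : Encoding β Γ₂) (f : α → β) : Prop :=
  Nonempty (Turing.TM2ComputableInPolyTime ea.encode eb.encode f)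

/-! Validity of the inequalities: the support of `a_j` is a cover, because `a_j` agrees with the
digits of `b` above `j`, while its weight `2 ^ j` at `j` exceeds everything the digits of `b` below
`j` can contribute (`mod_two_pow_lt_sum_coverCoeff`). A 0-1 point violating the inequality dominates
`a_j`, hence is too heavy.

Completeness (`coverPolytope_subset`) is by induction on the dimension, splitting off the top
coordinate `t`. If the top digit of `b` is 0, the inequality at that index forces `t = 0`. If it is
1, write `b = 2 ^ n + b'` and decompose `x = t (w / t, 1) + (1 - t) ((x - w) / (1 - t), 0)` with `w
= max 0 (x - (1 - t))`. The second point lies in a face of the cube all of whose vertices are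
feasible. The first reduces to capacity `b'`, and `sum_mul_max_le` shows that `w / t` inherits the
cover inequalities of `b'`.

The binarization is the graph of a linear map over this knapsack polytope, and convex hulls commute
with linear maps.

For computability, an explicit stack machine scans the digits of `b` from the top, keeping the
digits seen and a binary count of their ones. At a zero digit these determine the inequality, which
is pushed onto the output back to front. Each digit costs linear time, so the total is quadratic. -/

/-! ### Completeness of the cover inequalities. -/

theorem coverCoeff_eq_zero_or_one (b j k : ℕ) : coverCoeff b j k = 0 ∨ coverCoeff b j k = 1 := by
  unfold coverCoeff
  split_ifs
  · exact Or.inl rfl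
  · exact Or.inr rfl
  · cases b.testBit k
    · exact Or.inl rfl
    · exact Or.inr rfl

theorem coverCoeff_self (b j : ℕ) : coverCoeff b j j = 1 := by simp [coverCoeff]

theorem coverCoeff_of_lt {j k : ℕ} (b : ℕ) (h : k < j) : coverCoeff b j k = 0 := by
  simp [coverCoeff, h]

theorem coverCoeff_of_gt {j k : ℕ} (b : ℕ) (h : j < k) :
    coverCoeff b j k = (b.testBit k).toNat := by
  simp [coverCoeff, h.not_gt, h.ne']

theorem coverCoeff_congr {b b' j k : ℕ} (h : b.testBit k = b'.testBit k) :
    coverCoeff b j k = coverCoeff b' j k := by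
  simp [coverCoeff, h]

/-- The two numbers share their digits above `j`; at `j` the left one has digit 0, and its lower
part is less than `2 ^ j`. Reducing `b` modulo `2 ^ n` lets the induction strip top digits. -/
theorem mod_two_pow_lt_sum_coverCoeff {b j n : ℕ} (hj : j < n) (hb : b.testBit j = false) :
    b % 2 ^ n < ∑ k ∈ Finset.range n, coverCoeff b j k * 2 ^ k := by
  induction n with
  | zero => omega
  | succ n ih =>
    rw [Finset.sum_range_succ, Nat.mod_pow_succ, ← Nat.toNat_testBit]
    rcases Nat.lt_succ_iff_lt_or_eq.1 hj with h | rfl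
    · rw [coverCoeff_of_gt b h]
      have := ih h
      rw [Nat.mul_comm (2 ^ n)]
      omega
    · have := Nat.mod_lt b (Nat.two_pow_pos j)
      rw [hb, coverCoeff_self]
      simp only [Bool.toNat_false]
      omega

/-- The points of the cube satisfying the cover inequalities attached to the zero digits of `b`. -/
def coverPolytope (n b : ℕ) : Set (Fin n → ℝ) :=
  {x | (∀ i, 0 ≤ x i ∧ x i ≤ 1) ∧ ∀ j < n, b.testBit j = false →
    ∑ k : Fin n, (coverCoeff b j k : ℝ) * x k ≤ ∑ k : Fin n, (coverCoeff b j k : ℝ) - 1}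

theorem mem_convexHull_zero_one {n : ℕ} {x : Fin n → ℝ} (hx : ∀ i, 0 ≤ x i ∧ x i ≤ 1) :
    x ∈ convexHull ℝ {x : Fin n → ℝ | ∀ i, x i = 0 ∨ x i = 1} := by
  have h : {x : Fin n → ℝ | ∀ i, x i = 0 ∨ x i = 1} =
      Set.univ.pi fun _ : Fin n => ({0, 1} : Set ℝ) := by
    ext y
    simp [Set.mem_pi]
  rw [h, convexHull_pi]
  intro i _
  rw [convexHull_pair, segment_eq_Icc zero_le_one]
  exact hx i

/-- Appending a constant coordinate is an affine map, so it respects convex hulls; this lifts the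
induction hypothesis by one dimension. -/
theorem snoc_mem_convexHull {n : ℕ} {S : Set (Fin n → ℝ)} {T : Set (Fin (n + 1) → ℝ)} {t : ℝ}
    (h : ∀ s ∈ S, (Fin.snoc s t : Fin (n + 1) → ℝ) ∈ T) {y : Fin n → ℝ}
    (hy : y ∈ convexHull ℝ S) : (Fin.snoc y t : Fin (n + 1) → ℝ) ∈ convexHull ℝ T := by
  refine convexHull_min (t := {y | (Fin.snoc y t : Fin (n + 1) → ℝ) ∈ convexHull ℝ T})
    (fun s hs => subset_convexHull ℝ T (h s hs)) ?_ hy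
  intro y hy z hz a b ha hb hab
  have : (Fin.snoc (a • y + b • z) t : Fin (n + 1) → ℝ) =
      a • (Fin.snoc y t : Fin (n + 1) → ℝ) + b • (Fin.snoc z t : Fin (n + 1) → ℝ) := by
    ext i
    refine Fin.lastCases ?_ (fun i => ?_) i
    · simp [← add_mul, hab]
    · simp
  rw [Set.mem_ofPred_eq, this]
  exact convex_convexHull ℝ T hy hz ha hb hab

/-- A cover inequality stays valid, up to scaling, after truncating the point from below. -/
theorem sum_mul_max_le {ι : Type*} [Fintype ι] {c : ι → ℕ} (hc : ∀ i, c i = 0 ∨ c i = 1)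
    {x : ι → ℝ} {t : ℝ} (ht : 0 ≤ t) (hx : ∀ i, x i ≤ 1)
    (h : ∑ i, (c i : ℝ) * x i + t ≤ ∑ i, (c i : ℝ)) :
    ∑ i, (c i : ℝ) * max 0 (x i - (1 - t)) ≤ (∑ i, (c i : ℝ) - 1) * t := by
  -- If some index of the support is truncated to 0, its slack alone is `t` and all other slacks `t
  -- - max 0 _` are nonnegative.
  by_cases hi : ∃ i, c i = 1 ∧ x i ≤ 1 - t
  · obtain ⟨i, hci, hxi⟩ := hi
    have h1 : (c i : ℝ) * (t - max 0 (x i - (1 - t))) ≤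
        ∑ i, (c i : ℝ) * (t - max 0 (x i - (1 - t))) := by
      refine Finset.single_le_sum (f := fun i => (c i : ℝ) * (t - max 0 (x i - (1 - t))))
        (fun k _ => mul_nonneg (Nat.cast_nonneg _) ?_) (Finset.mem_univ i)
      rw [sub_nonneg]
      exact max_le ht (by linarith [hx k])
    rw [max_eq_left (by linarith), hci] at h1
    simp only [mul_sub, Finset.sum_sub_distrib, ← Finset.sum_mul] at h1
    push_cast at h1
    linarith
  -- No truncation occurs on the support, so the left side is linear in `x` and `h` gives the bound.
  · push Not at hi
    have h2 : ∀ i, (c i : ℝ) * max 0 (x i - (1 - t)) = c i * x i - c i * (1 - t) := by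
      intro i
      rcases hc i with h0 | h1
      · simp [h0]
      · rw [max_eq_right (by linarith [hi i h1]), mul_sub]
    simp only [h2, Finset.sum_sub_distrib, ← Finset.sum_mul]
    linarith

theorem knapsack_snoc_zero {n b : ℕ} {x : Fin n → ℝ} (hx : ∀ i, x i = 0 ∨ x i = 1)
    (h : ∑ i : Fin n, (2 : ℝ) ^ (i : ℕ) * x i ≤ (b : ℝ)) :
    (Fin.snoc x 0 : Fin (n + 1) → ℝ) ∈ {x : Fin (n + 1) → ℝ | (∀ i, x i = 0 ∨ x i = 1) ∧
      ∑ i : Fin (n + 1), (2 : ℝ) ^ (i : ℕ) * x i ≤ (b : ℝ)} := by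
  refine ⟨fun i => ?_, by simpa [Fin.sum_univ_castSucc] using h⟩
  refine Fin.lastCases (by simp) (fun i => by simpa using hx i) i

theorem sum_two_pow_mul_le {n : ℕ} {x : Fin n → ℝ} (hx : ∀ i, x i ≤ 1) :
    ∑ i : Fin n, (2 : ℝ) ^ (i : ℕ) * x i ≤ 2 ^ n - 1 := by
  calc ∑ i : Fin n, (2 : ℝ) ^ (i : ℕ) * x i ≤ ∑ i : Fin n, (2 : ℝ) ^ (i : ℕ) :=
        Finset.sum_le_sum fun i _ => mul_le_of_le_one_right (by positivity) (hx i)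
    _ = 2 ^ n - 1 := by
        rw [Fin.sum_univ_eq_sum_range (fun i => (2 : ℝ) ^ i), geom_sum_eq (by norm_num)]
        norm_num

theorem le_one_of_zero_or_one {a : ℝ} (h : a = 0 ∨ a = 1) : 0 ≤ a ∧ a ≤ 1 := by
  rcases h with rfl | rfl <;> norm_num

theorem coverPolytope_subset {n b : ℕ} (hb : b < 2 ^ n) :
    coverPolytope n b ⊆ knapsackPolytope n b := by
  induction n generalizing b with
  | zero =>
    intro x _
    exact subset_convexHull ℝ _ ⟨fun i => i.elim0, by simp⟩
  | succ n ih =>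
    rintro x ⟨hx, hcov⟩
    have hxs : x = Fin.snoc (fun i : Fin n => x i.castSucc) (x (Fin.last n)) :=
      (Fin.snoc_init_self x).symm
    cases hbit : b.testBit n with
    | false =>
      have hbn : b < 2 ^ n := by
        by_contra hlt
        rw [Nat.testBit_of_two_pow_le_and_two_pow_add_one_gt (not_lt.1 hlt) hb] at hbit
        exact Bool.noConfusion hbit
      have h0 : x (Fin.last n) = 0 := by
        have h := hcov n (Nat.lt_succ_self n) hbit
        have hz : ∀ k : Fin n, coverCoeff b n k = 0 := fun k => coverCoeff_of_lt b k.2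
        simp only [Fin.sum_univ_castSucc, Fin.val_castSucc, Fin.val_last, hz, coverCoeff_self] at h
        simp only [Nat.cast_zero, zero_mul, Finset.sum_const_zero, Nat.cast_one, zero_add,
          one_mul, sub_self] at h
        exact le_antisymm h (hx _).1
      rw [hxs, h0]
      refine snoc_mem_convexHull (S := {x : Fin n → ℝ | (∀ i, x i = 0 ∨ x i = 1) ∧
        ∑ i : Fin n, (2 : ℝ) ^ (i : ℕ) * x i ≤ (b : ℝ)})
        (fun s hs => knapsack_snoc_zero hs.1 hs.2) (ih hbn ⟨fun i => hx _, fun j hj hbj => ?_⟩)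
      have h := hcov j (by omega) hbj
      have hz : coverCoeff b j n = 0 := by rw [coverCoeff_of_gt b hj, hbit]; rfl
      simpa [Fin.sum_univ_castSucc, hz] using h
    | true =>
      obtain ⟨b', rfl⟩ := Nat.exists_eq_add_of_le (Nat.ge_two_pow_of_testBit hbit)
      have hb' : b' < 2 ^ n := by rw [pow_succ] at hb; omega
      have hbits : ∀ k < n, (2 ^ n + b').testBit k = b'.testBit k := fun k hk =>
        Nat.testBit_two_pow_add_gt hk b'
      set t := x (Fin.last n) with ht
      obtain ⟨ht0, ht1⟩ := hx (Fin.last n)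
      rw [← ht] at ht0 ht1
      -- The smallest nonnegative `w` leaving a remainder `x - w` of at most `1 - t`.
      set w : Fin n → ℝ := fun i => max 0 (x i.castSucc - (1 - t)) with hw
      have hw0 : ∀ i, 0 ≤ w i := fun i => le_max_left _ _
      have hwt : ∀ i, w i ≤ t := fun i => max_le ht0 (by linarith [(hx i.castSucc).2])
      have hwx : ∀ i, w i ≤ x i.castSucc := fun i => max_le (hx _).1 (by linarith)
      have hwx' : ∀ i, x i.castSucc - w i ≤ 1 - t := fun i => by
        have : x i.castSucc - (1 - t) ≤ w i := le_max_right _ _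
        linarith
      have hu : (fun i => w i / t) ∈ coverPolytope n b' := by
        refine ⟨fun i => ⟨div_nonneg (hw0 i) ht0, div_le_one_of_le₀ (hwt i) ht0⟩,
          fun j hj hbj => ?_⟩
        have hcongr : ∀ k : Fin n, coverCoeff (2 ^ n + b') j k = coverCoeff b' j k :=
          fun k => coverCoeff_congr (hbits k k.2)
        have h := hcov j (by omega) ((hbits j hj).trans hbj)
        have hn : coverCoeff (2 ^ n + b') j n = 1 := by rw [coverCoeff_of_gt _ hj, hbit]; rfl
        simp only [Fin.sum_univ_castSucc, Fin.val_castSucc, Fin.val_last, hcongr, hn,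
          Nat.cast_one, one_mul, add_sub_cancel_right] at h
        have h2 := sum_mul_max_le (fun k : Fin n => coverCoeff_eq_zero_or_one b' j k) ht0
          (fun i => (hx i.castSucc).2) h
        -- Makes the right-hand side nonnegative, which settles `t = 0`, where `w / t` is 0 by
        -- convention.
        have h1 : (1 : ℝ) ≤ ∑ k : Fin n, (coverCoeff b' j k : ℝ) := by
          have := Finset.single_le_sum (f := fun k : Fin n => (coverCoeff b' j k : ℝ))
            (fun k _ => Nat.cast_nonneg _) (Finset.mem_univ ⟨j, hj⟩)
          simpa [coverCoeff_self] using this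
        simp only [← mul_div_assoc, ← Finset.sum_div]
        exact div_le_of_le_mul₀ ht0 (by linarith) h2
      have hxuv : x = t • (Fin.snoc (fun i => w i / t) 1 : Fin (n + 1) → ℝ) +
          (1 - t) • (Fin.snoc (fun i : Fin n => (x i.castSucc - w i) / (1 - t)) 0 :
            Fin (n + 1) → ℝ) := by
        ext i
        refine Fin.lastCases ?_ (fun i => ?_) i
        · simp [ht]
        -- The cancellations survive zero denominators: `0 ≤ w ≤ t` and `0 ≤ x - w ≤ 1 - t` make the
        -- numerators vanish too.
        · have e1 : t * (w i / t) = w i :=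
            mul_div_cancel_of_imp' fun h => le_antisymm (h ▸ hwt i) (hw0 i)
          have e2 : (1 - t) * ((x i.castSucc - w i) / (1 - t)) = x i.castSucc - w i :=
            mul_div_cancel_of_imp' fun h =>
              le_antisymm (h ▸ hwx' i) (by linarith [hwx i])
          simp [e1, e2]
      rw [hxuv]
      refine convex_convexHull ℝ _ ?_ ?_ ht0 (by linarith) (by ring)
      · refine snoc_mem_convexHull (fun s hs => ?_) (ih hb' hu)
        refine ⟨fun i => ?_, ?_⟩
        · exact Fin.lastCases (by simp) (fun i => by simpa using hs.1 i) i
        · have := hs.2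
          change ∑ i : Fin (n + 1), (2 : ℝ) ^ (i : ℕ) * (Fin.snoc s 1 : Fin (n + 1) → ℝ) i ≤ _
          simp only [Fin.sum_univ_castSucc, Fin.snoc_castSucc, Fin.snoc_last, Fin.val_castSucc,
            Fin.val_last]
          push_cast
          linarith
      -- Without the top weight a 0-1 vector weighs at most `2 ^ n - 1 < b`, so membership in the
      -- cube suffices.
      · refine snoc_mem_convexHull (fun s hs => knapsack_snoc_zero hs ?_)
          (mem_convexHull_zero_one fun i => ⟨div_nonneg (by linarith [hwx i]) (by linarith),
            div_le_one_of_le₀ (hwx' i) (by linarith)⟩)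
        have := sum_two_pow_mul_le fun i => (le_one_of_zero_or_one (hs i)).2
        push_cast
        have : (0 : ℝ) ≤ b' := Nat.cast_nonneg _
        linarith

/-! ### Validity of the cover inequalities. -/

theorem convex_coverPolytope (n b : ℕ) : Convex ℝ (coverPolytope n b) := by
  rintro x ⟨hx, hx'⟩ y ⟨hy, hy'⟩ s t hs ht hst
  refine ⟨fun i => ?_, fun j hj hb => ?_⟩
  · simp only [Pi.add_apply, Pi.smul_apply, smul_eq_mul]
    constructor
    · exact add_nonneg (mul_nonneg hs (hx i).1) (mul_nonneg ht (hy i).1)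
    · nlinarith [(hx i).2, (hy i).2]
  · simp only [Pi.add_apply, Pi.smul_apply, smul_eq_mul, mul_add, Finset.sum_add_distrib,
      mul_left_comm _ s, mul_left_comm _ t, ← Finset.mul_sum]
    have h1 := mul_le_mul_of_nonneg_left (hx' j hj hb) hs
    have h2 := mul_le_mul_of_nonneg_left (hy' j hj hb) ht
    have h3 : ∀ a : ℝ, s * a + t * a = a := fun a => by rw [← add_mul, hst, one_mul]
    linarith [h3 (∑ k : Fin n, (coverCoeff b j k : ℝ) - 1)]

theorem knapsackPolytope_subset {n b : ℕ} (hb : b < 2 ^ n) :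
    knapsackPolytope n b ⊆ coverPolytope n b := by
  refine convexHull_min ?_ (convex_coverPolytope n b)
  rintro x ⟨hx, hxb⟩
  refine ⟨fun i => le_one_of_zero_or_one (hx i), fun j hj hbj => ?_⟩
  by_contra! hlt
  have hle : ∀ k : Fin n, (coverCoeff b j k : ℝ) ≤ x k := by
    intro k
    by_contra! hk
    -- For 0-1 values the failure means coefficient 1 and `x k = 0`; this one term already gives the
    -- inequality a slack of 1, so it is not violated.
    have hk1 : (coverCoeff b j k : ℝ) * (1 - x k) = 1 := by
      rcases coverCoeff_eq_zero_or_one b j k with h | h <;> rcases hx k with h' | h' <;>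
        first | (exfalso; norm_num [h, h'] at hk; done) | norm_num [h, h']
    have := Finset.single_le_sum (f := fun k : Fin n => (coverCoeff b j k : ℝ) * (1 - x k))
      (fun k _ => mul_nonneg (Nat.cast_nonneg _)
        (by linarith [(le_one_of_zero_or_one (hx k)).2])) (Finset.mem_univ k)
    simp only [hk1, mul_sub, mul_one, Finset.sum_sub_distrib] at this
    linarith
  have h1 : (∑ k : Fin n, (coverCoeff b j k : ℝ) * 2 ^ (k : ℕ)) ≤ b := by
    refine le_trans (Finset.sum_le_sum fun k _ => ?_) hxb
    rw [mul_comm]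
    exact mul_le_mul_of_nonneg_left (hle k) (by positivity)
  rw [Fin.sum_univ_eq_sum_range (fun k => (coverCoeff b j k : ℝ) * 2 ^ k)] at h1
  have h2 := mod_two_pow_lt_sum_coverCoeff hj hbj
  rw [Nat.mod_eq_of_lt hb] at h2
  have h3 : ((∑ k ∈ Finset.range n, coverCoeff b j k * 2 ^ k : ℕ) : ℝ) ≤ (b : ℝ) := by
    push_cast
    exact h1
  exact absurd (Nat.cast_le.1 h3) (by omega)

theorem knapsackPolytope_eq_coverPolytope {n b : ℕ} (hb : b < 2 ^ n) :
    knapsackPolytope n b = coverPolytope n b :=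
  (knapsackPolytope_subset hb).antisymm (coverPolytope_subset hb)

theorem knapsackPolytope_of_le {n b : ℕ} (hb : 2 ^ n ≤ b) :
    knapsackPolytope n b = {x | ∀ i, 0 ≤ x i ∧ x i ≤ 1} := by
  have hb' : (2 : ℝ) ^ n ≤ b := by exact_mod_cast hb
  refine Set.Subset.antisymm (convexHull_min (fun x hx i => le_one_of_zero_or_one (hx.1 i)) ?_) ?_
  · have : {x : Fin n → ℝ | ∀ i, 0 ≤ x i ∧ x i ≤ 1} = Set.Icc 0 1 := by
      ext x
      simp [Pi.le_def, forall_and]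
    rw [this]
    exact convex_Icc 0 1
  · intro x hx
    refine convexHull_mono (t := {x : Fin n → ℝ | (∀ i, x i = 0 ∨ x i = 1) ∧
      ∑ i : Fin n, (2 : ℝ) ^ (i : ℕ) * x i ≤ (b : ℝ)}) (fun y hy => ⟨hy, ?_⟩)
      (mem_convexHull_zero_one hx)
    have := sum_two_pow_mul_le fun i => (le_one_of_zero_or_one (hy i)).2
    linarith

/-! ### The explicit list of inequalities. -/

theorem one_le_sum_coverCoeff {n b j : ℕ} (hj : j < n) :
    1 ≤ ∑ k ∈ Finset.range n, coverCoeff b j k :=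
  (coverCoeff_self b j).ge.trans
    (Finset.single_le_sum (fun _ _ => Nat.zero_le _) (Finset.mem_range.2 hj))

theorem coverIneq_holdsAt_iff {n b j : ℕ} (hj : j < n) (x : Fin n → ℝ) :
    (coverIneq n b j).HoldsAt x ↔
      ∑ k : Fin n, (coverCoeff b j k : ℝ) * x k ≤ ∑ k : Fin n, (coverCoeff b j k : ℝ) - 1 := by
  rw [NatIneq.HoldsAt, Fin.sum_univ_eq_sum_range (fun k => (coverCoeff b j k : ℝ))]
  simp only [coverIneq]
  rw [Nat.cast_sub (one_le_sum_coverCoeff hj)]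
  push_cast
  simp

theorem mem_coverSystem {n b : ℕ} (hb : b < 2 ^ n) (r : NatIneq) :
    r ∈ coverSystem n b ↔ ∃ j < n, b.testBit j = false ∧ coverIneq n b j = r := by
  simp [coverSystem, not_le.2 hb, and_assoc]

theorem knapsackPolytope_eq (n b : ℕ) : knapsackPolytope n b =
    {x | (∀ i, 0 ≤ x i ∧ x i ≤ 1) ∧ ∀ r ∈ coverSystem n b, r.HoldsAt x} := by
  rcases lt_or_ge b (2 ^ n) with hb | hb
  · rw [knapsackPolytope_eq_coverPolytope hb]
    ext x
    refine and_congr_right fun _ => ⟨fun h r hr => ?_, fun h j hj hbj => ?_⟩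
    · obtain ⟨j, hj, hbj, rfl⟩ := (mem_coverSystem hb r).1 hr
      exact (coverIneq_holdsAt_iff hj x).2 (h j hj hbj)
    · exact (coverIneq_holdsAt_iff hj x).1 (h _ ((mem_coverSystem hb _).2 ⟨j, hj, hbj, rfl⟩))
  · rw [knapsackPolytope_of_le hb]
    simp [coverSystem, hb]

theorem isCoverIneq_of_mem_coverSystem {n b : ℕ} {r : NatIneq} (hr : r ∈ coverSystem n b) :
    IsCoverIneq n b r := by
  have hb : b < 2 ^ n := by
    by_contra h
    simp [coverSystem, not_lt.1 h] at hr
  obtain ⟨j, hj, hbj, rfl⟩ := (mem_coverSystem hb r).1 hr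
  have hcoeff : ∀ k, (if coverCoeff b j k = 1 then 1 else 0) = coverCoeff b j k := fun k => by
    rcases coverCoeff_eq_zero_or_one b j k with h | h <;> simp [h]
  refine ⟨Finset.univ.filter fun k : Fin n => coverCoeff b j k = 1, ?_, ?_, ?_⟩
  · have h := mod_two_pow_lt_sum_coverCoeff hj hbj
    rw [Nat.mod_eq_of_lt hb] at h
    refine h.trans_eq ?_
    rw [Finset.sum_filter, ← Fin.sum_univ_eq_sum_range (fun k => coverCoeff b j k * 2 ^ k)]
    refine Finset.sum_congr rfl fun k _ => ?_
    rcases coverCoeff_eq_zero_or_one b j k with h | h <;> simp [h]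
  · refine List.ext_getElem (by simp [coverIneq]) fun k h1 h2 => ?_
    simp [coverIneq, hcoeff]
  · rw [Finset.card_filter]
    simp only [hcoeff]
    rw [Fin.sum_univ_eq_sum_range (fun k => coverCoeff b j k), coverIneq]
    exact Nat.sub_add_cancel (one_le_sum_coverCoeff hj)

/-- A positive `b < 2 ^ n` has a digit 1 below `n`, so the filter drops at least one index. -/
theorem length_coverSystem_le {n b : ℕ} (hb : 0 < b) : (coverSystem n b).length ≤ n - 1 := by
  unfold coverSystem
  split_ifs with h
  · simp
  · have h0 : ∃ j < n, b.testBit j = true := by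
      by_contra! hne
      refine hb.ne' (Nat.eq_of_testBit_eq fun j => ?_)
      rw [Nat.zero_testBit]
      rcases lt_or_ge j n with hj | hj
      · simpa using hne j hj
      · exact Nat.testBit_lt_two_pow ((not_le.1 h).trans_le (Nat.pow_le_pow_right two_pos hj))
    obtain ⟨j, hj, hbj⟩ := h0
    have := List.length_filter_lt_length_iff_exists (l := List.range n)
      (p := fun j => !b.testBit j) |>.2 ⟨j, List.mem_range.2 hj, by simp [hbj]⟩
    rw [List.length_range] at this
    rw [List.length_map]
    omega

/-! ### The logarithmic binarization. -/

theorem perfectLogBinarization_eq (u : ℕ) : perfectLogBinarization u =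
    {p | p.1 = ∑ j : Fin (logDim u), (2 : ℝ) ^ (j : ℕ) * p.2 j ∧ (∀ j, 0 ≤ p.2 j ∧ p.2 j ≤ 1) ∧
      ∀ r ∈ coverSystem (logDim u) u, r.HoldsAt p.2} := by
  let φ : (Fin (logDim u) → ℝ) →ₗ[ℝ] ℝ :=
    ∑ j : Fin (logDim u), (2 : ℝ) ^ (j : ℕ) • LinearMap.proj j
  have hφ : ∀ z, (φ.prod LinearMap.id) z = (∑ j : Fin (logDim u), (2 : ℝ) ^ (j : ℕ) * z j, z) :=
    fun z => Prod.ext (by simp [φ]) rfl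
  -- For 0-1 vectors `z` the bound `0 ≤ x` is automatic and `x ≤ u` is the knapsack constraint.
  have h1 : logBinarization u ∩ {p | ∀ j, p.2 j = 0 ∨ p.2 j = 1} =
      (φ.prod LinearMap.id) '' {x | (∀ i, x i = 0 ∨ x i = 1) ∧
        ∑ i : Fin (logDim u), (2 : ℝ) ^ (i : ℕ) * x i ≤ (u : ℝ)} := by
    ext ⟨x, z⟩
    constructor
    · rintro ⟨⟨⟨-, h1⟩, -, h3⟩, h4⟩
      exact ⟨z, ⟨h4, h3 ▸ h1⟩, (hφ z).trans (Prod.ext h3.symm rfl)⟩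
    · rintro ⟨y, ⟨h1, h2⟩, h3⟩
      rw [← h3, hφ]
      have h0 : 0 ≤ ∑ j : Fin (logDim u), (2 : ℝ) ^ (j : ℕ) * y j :=
        Finset.sum_nonneg fun i _ => mul_nonneg (by positivity) (le_one_of_zero_or_one (h1 i)).1
      exact ⟨⟨⟨h0, h2⟩, fun i => le_one_of_zero_or_one (h1 i), rfl⟩, h1⟩
  rw [perfectLogBinarization, h1, ← LinearMap.image_convexHull]
  change (φ.prod LinearMap.id) '' knapsackPolytope (logDim u) u = _
  rw [knapsackPolytope_eq]
  ext ⟨x, z⟩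
  constructor
  · rintro ⟨y, h1, h3⟩
    rw [← h3, hφ]
    exact ⟨rfl, h1⟩
  · rintro ⟨h1, h2⟩
    exact ⟨z, h2, (hφ z).trans (Prod.ext h1.symm rfl)⟩

/-! ### Runs with a step bound. -/

open Turing StateTransition

/-- `f` leads from `a` to `b` in at most `t` steps. -/
def EvalsIn {σ : Type*} (f : σ → Option σ) (a b : σ) (t : ℕ) : Prop :=
  Nonempty (EvalsToInTime f a (some b) t)

namespace EvalsIn

variable {σ : Type*} {f : σ → Option σ} {a b c : σ} {s t : ℕ}

theorem single (h : f a = some b) : EvalsIn f a b 1 := ⟨⟨⟨1, h⟩, le_rfl⟩⟩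

theorem trans (h₁ : EvalsIn f a b s) (h₂ : EvalsIn f b c t) : EvalsIn f a c (s + t) := by
  obtain ⟨h₁⟩ := h₁
  obtain ⟨h₂⟩ := h₂
  rw [add_comm]
  exact ⟨EvalsToInTime.trans f _ _ a b _ h₁ h₂⟩

theorem mono (h : EvalsIn f a b s) (hst : s ≤ t) : EvalsIn f a b t := by
  obtain ⟨h⟩ := h
  exact ⟨⟨h.toEvalsTo, h.steps_le_m.trans hst⟩⟩

theorem head (h : f a = some b) (h' : EvalsIn f b c t) : EvalsIn f a c (t + 1) :=
  ((single h).trans h').mono (add_comm 1 t).le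

end EvalsIn

/-! ### The stack machine and the running times of its loops. -/

namespace CoverMachine

/-- The stacks: the input, the digits of `b` still to be processed, the digits processed so far,
the number of ones among the latter in binary, an auxiliary stack, and the output. -/
inductive Stack
  | inp | low | high | cnt | tmp | out
  deriving DecidableEq

instance : Fintype Stack where
  elems := {.inp, .low, .high, .cnt, .tmp, .out}
  complete k := by cases k <;> simp

inductive Label
  | read | pad | next | cntFwd | cntBack | highFwd | highBack | lowFwd | lowBack | clear
  deriving DecidableEq

instance : Fintype Label where
  elems := {.read, .pad, .next, .cntFwd, .cntBack, .highFwd, .highBack, .lowFwd, .lowBack, .clear}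
  complete k := by cases k <;> simp

/-- The registers: the symbol just read, the digit being processed, and a carry. -/
structure Reg where
  cur : Option Bool
  digit : Bool
  carry : Bool
  deriving DecidableEq, Fintype

abbrev Alph (I : Type) : Stack → Type
  | .inp => I
  | .out => Γ'
  | _ => Bool

/-- The registers at the start and at the end. -/
def Reg.init : Reg := ⟨none, false, false⟩

def Reg.val (s : Reg) : Bool := s.cur.getD false

def Reg.set (s : Reg) (x : Option Bool) : Reg := ⟨x, s.digit, s.carry⟩

abbrev Stm (I : Type) : Type := TM2.Stmt (Alph I) Label Reg

abbrev Conf (I : Type) : Type := TM2.Cfg (Alph I) Label Reg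

open TM2.Stmt in
/-- The program, up to the statement that reads an input symbol. -/
def prog {I : Type} (rd : Stm I) : Label → Stm I
  | .read => rd
  | .pad => pop .tmp Reg.set <| branch (fun s => s.cur.isNone) (goto fun _ => .next) <|
      push .low (fun _ => false) <| goto fun _ => .pad
  | .next => pop .low (fun _ x => ⟨x, x.getD false, x.getD false⟩) <|
      branch (fun s => s.cur.isNone) (goto fun _ => .clear) <|
      branch Reg.digit (goto fun _ => .cntFwd) <|
      push .out (fun _ => Γ'.ket) <| goto fun _ => .cntFwd
  | .cntFwd => pop .cnt Reg.set <| branch (fun s => s.cur.isNone)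
      (branch Reg.carry
        (push .tmp (fun _ => true) <| load (fun s => ⟨none, s.digit, false⟩) <|
          goto fun _ => .cntBack)
        (goto fun _ => .cntBack)) <|
      push .tmp (fun s => xor s.val s.carry) <|
      load (fun s => ⟨none, s.digit, s.val && s.carry⟩) <| goto fun _ => .cntFwd
  | .cntBack => pop .tmp Reg.set <| branch (fun s => s.cur.isNone)
      (branch Reg.digit (push .high (fun _ => true) <| goto fun _ => .next)
        (goto fun _ => .highFwd)) <|
      push .cnt Reg.val <| branch Reg.digit (goto fun _ => .cntBack) <|
      push .out (fun s => Γ'.bit s.val) <| goto fun _ => .cntBack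
  | .highFwd => pop .high Reg.set <| branch (fun s => s.cur.isNone) (goto fun _ => .highBack) <|
      push .tmp Reg.val <| goto fun _ => .highFwd
  | .highBack => pop .tmp Reg.set <| push .out (fun _ => Γ'.comma) <|
      branch (fun s => s.cur.isNone)
      (push .out (fun _ => Γ'.bit true) <| goto fun _ => .lowFwd) <|
      push .high Reg.val <| branch Reg.val
      (push .out (fun _ => Γ'.bit true) <| goto fun _ => .highBack) (goto fun _ => .highBack)
  | .lowFwd => pop .low Reg.set <| branch (fun s => s.cur.isNone) (goto fun _ => .lowBack) <|
      push .tmp Reg.val <| push .out (fun _ => Γ'.comma) <| goto fun _ => .lowFwd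
  | .lowBack => pop .tmp Reg.set <| branch (fun s => s.cur.isNone)
      (push .high (fun _ => false) <| goto fun _ => .next) <|
      push .low Reg.val <| goto fun _ => .lowBack
  | .clear => pop .inp (fun s x => s.set (x.map fun _ => true)) <|
      branch (fun s => s.cur.isSome) (goto fun _ => .clear) <|
      pop .low Reg.set <| branch (fun s => s.cur.isSome) (goto fun _ => .clear) <|
      pop .high Reg.set <| branch (fun s => s.cur.isSome) (goto fun _ => .clear) <|
      pop .cnt Reg.set <| branch (fun s => s.cur.isSome) (goto fun _ => .clear) <|
      load (fun _ => Reg.init) halt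

/-- The configuration with the given contents of the stacks. -/
def stk {I : Type} (i : List I) (l h c t : List Bool) (o : List Γ') : ∀ k, List (Alph I k)
  | .inp => i
  | .low => l
  | .high => h
  | .cnt => c
  | .tmp => t
  | .out => o

/-- Comparing configurations componentwise, and the stacks one at a time, leaves goals that hold by
`rfl`. -/
theorem step_eq {I : Type} {m : Label → Stm I} {l : Label} {v : Reg} {S : ∀ k, List (Alph I k)}
    {l' : Option Label} {v' : Reg} {S' : ∀ k, List (Alph I k)}
    (h1 : (TM2.stepAux (m l) v S).l = l') (h2 : (TM2.stepAux (m l) v S).var = v')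
    (h3 : ∀ k, (TM2.stepAux (m l) v S).stk k = S' k) :
    TM2.step m (⟨some l, v, S⟩ : Conf I) = some ⟨l', v', S'⟩ := by
  rw [TM2.step]
  generalize TM2.stepAux (m l) v S = x at *
  obtain ⟨a, b, s⟩ := x
  simp only at h1 h2 h3
  rw [h1, h2, funext h3]

variable {I : Type} (rd : Stm I)

/-- Binary numbers, least significant digit first, plus a carry. -/
def addCarry : List Bool → Bool → List Bool
  | [], false => []
  | [], true => [true]
  | x :: c, a => xor x a :: addCarry c (x && a)

theorem addCarry_false (c : List Bool) : addCarry c false = c := by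
  induction c with
  | nil => rfl
  | cons x c ih => simp [addCarry, ih]

theorem length_addCarry_le (c : List Bool) (a : Bool) : (addCarry c a).length ≤ c.length + 1 := by
  induction c generalizing a with
  | nil => cases a <;> simp [addCarry]
  | cons x c ih => simpa [addCarry] using ih _

/-- The carry enters equal to the current digit, so the count is incremented exactly at the ones. -/
theorem evalsIn_cntFwd (s : Option Bool) (d a : Bool) (i : List I) (l h c t : List Bool)
    (o : List Γ') : EvalsIn (TM2.step (prog rd)) ⟨some .cntFwd, ⟨s, d, a⟩, stk i l h c t o⟩
      ⟨some .cntBack, ⟨none, d, false⟩, stk i l h [] ((addCarry c a).reverse ++ t) o⟩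
      (c.length + 1) := by
  induction c generalizing s a t with
  | nil =>
    cases a <;>
    exact .single (step_eq rfl rfl fun k => by cases k <;> rfl)
  | cons x c ih =>
    refine .head (step_eq (l' := some .cntFwd) (v' := ⟨none, d, x && a⟩)
      (S' := stk i l h c (xor x a :: t) o) rfl rfl fun k => by cases k <;> rfl) ?_
    simpa [addCarry] using ih none (x && a) (xor x a :: t)

theorem evalsIn_cntBack_true (s : Option Bool) (a : Bool) (i : List I) (l h c t : List Bool)
    (o : List Γ') : EvalsIn (TM2.step (prog rd)) ⟨some .cntBack, ⟨s, true, a⟩, stk i l h c t o⟩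
      ⟨some .next, ⟨none, true, a⟩, stk i l (true :: h) (t.reverse ++ c) [] o⟩
      (t.length + 1) := by
  induction t generalizing s c with
  | nil => exact .single (step_eq rfl rfl fun k => by cases k <;> rfl)
  | cons x t ih =>
    refine .head (step_eq (l' := some .cntBack) (v' := ⟨some x, true, a⟩)
      (S' := stk i l h (x :: c) t o) rfl rfl fun k => by cases k <;> rfl) ?_
    simpa using ih (some x) (x :: c)

/-- At a zero digit the loop restoring the counter also writes it out as the right-hand side. -/
theorem evalsIn_cntBack_false (s : Option Bool) (a : Bool) (i : List I) (l h c t : List Bool)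
    (o : List Γ') : EvalsIn (TM2.step (prog rd)) ⟨some .cntBack, ⟨s, false, a⟩, stk i l h c t o⟩
      ⟨some .highFwd, ⟨none, false, a⟩,
        stk i l h (t.reverse ++ c) [] (t.reverse.map Γ'.bit ++ o)⟩ (t.length + 1) := by
  induction t generalizing s c o with
  | nil => exact .single (step_eq rfl rfl fun k => by cases k <;> rfl)
  | cons x t ih =>
    refine .head (step_eq (l' := some .cntBack) (v' := ⟨some x, false, a⟩)
      (S' := stk i l h (x :: c) t (Γ'.bit x :: o)) rfl rfl fun k => by cases k <;> rfl) ?_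
    simpa using ih (some x) (x :: c) (Γ'.bit x :: o)

theorem evalsIn_highFwd (s : Option Bool) (d a : Bool) (i : List I) (l h c t : List Bool)
    (o : List Γ') : EvalsIn (TM2.step (prog rd)) ⟨some .highFwd, ⟨s, d, a⟩, stk i l h c t o⟩
      ⟨some .highBack, ⟨none, d, a⟩, stk i l [] c (h.reverse ++ t) o⟩ (h.length + 1) := by
  induction h generalizing s t with
  | nil => exact .single (step_eq rfl rfl fun k => by cases k <;> rfl)
  | cons x h ih =>
    refine .head (step_eq (l' := some .highFwd) (v' := ⟨some x, d, a⟩)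
      (S' := stk i l h c (x :: t) o) rfl rfl fun k => by cases k <;> rfl) ?_
    simpa using ih (some x) (x :: t)

/-- A coefficient in binary, followed by a comma. -/
def coeffWord (x : Bool) : List Γ' := cond x [Γ'.bit true, Γ'.comma] [Γ'.comma]

theorem evalsIn_highBack (s : Option Bool) (d a : Bool) (i : List I) (l h c t : List Bool)
    (o : List Γ') : EvalsIn (TM2.step (prog rd)) ⟨some .highBack, ⟨s, d, a⟩, stk i l h c t o⟩
      ⟨some .lowFwd, ⟨none, d, a⟩, stk i l (t.reverse ++ h) c []
        (Γ'.bit true :: Γ'.comma :: (t.reverse.flatMap coeffWord ++ o))⟩ (t.length + 1) := by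
  induction t generalizing s h o with
  | nil => exact .single (step_eq rfl rfl fun k => by cases k <;> rfl)
  | cons x t ih =>
    refine .head (step_eq (l' := some .highBack) (v' := ⟨some x, d, a⟩)
      (S' := stk i l (x :: h) c t (coeffWord x ++ o)) (by cases x <;> rfl) (by cases x <;> rfl)
      fun k => by cases k <;> cases x <;> rfl) ?_
    simpa using ih (some x) (x :: h) (coeffWord x ++ o)

theorem evalsIn_lowFwd (s : Option Bool) (d a : Bool) (i : List I) (l h c t : List Bool)
    (o : List Γ') : EvalsIn (TM2.step (prog rd)) ⟨some .lowFwd, ⟨s, d, a⟩, stk i l h c t o⟩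
      ⟨some .lowBack, ⟨none, d, a⟩,
        stk i [] h c (l.reverse ++ t) (List.replicate l.length Γ'.comma ++ o)⟩
      (l.length + 1) := by
  induction l generalizing s t o with
  | nil => exact .single (step_eq rfl rfl fun k => by cases k <;> rfl)
  | cons x l ih =>
    refine .head (step_eq (l' := some .lowFwd) (v' := ⟨some x, d, a⟩)
      (S' := stk i l h c (x :: t) (Γ'.comma :: o)) rfl rfl fun k => by cases k <;> rfl) ?_
    simpa [List.replicate_succ'] using ih (some x) (x :: t) (Γ'.comma :: o)

theorem evalsIn_lowBack (s : Option Bool) (d a : Bool) (i : List I) (l h c t : List Bool)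
    (o : List Γ') : EvalsIn (TM2.step (prog rd)) ⟨some .lowBack, ⟨s, d, a⟩, stk i l h c t o⟩
      ⟨some .next, ⟨none, d, a⟩, stk i (t.reverse ++ l) (false :: h) c [] o⟩
      (t.length + 1) := by
  induction t generalizing s l with
  | nil => exact .single (step_eq rfl rfl fun k => by cases k <;> rfl)
  | cons x t ih =>
    refine .head (step_eq (l' := some .lowBack) (v' := ⟨some x, d, a⟩)
      (S' := stk i (x :: l) h c t o) rfl rfl fun k => by cases k <;> rfl) ?_
    simpa using ih (some x) (x :: l)

/-- Halting requires initial registers and only the output nonempty. Each step but the last removes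
exactly one symbol. -/
theorem evalsIn_clear (s : Reg) (i : List I) (l h c : List Bool) (o : List Γ') :
    EvalsIn (TM2.step (prog rd)) ⟨some .clear, s, stk i l h c [] o⟩
      ⟨none, Reg.init, stk [] [] [] [] [] o⟩ (i.length + l.length + h.length + c.length + 1) := by
  induction i generalizing s with
  | cons x i ih =>
    exact (EvalsIn.head (step_eq (l' := some .clear) (v' := s.set (some true))
      (S' := stk i l h c [] o) rfl rfl fun k => by cases k <;> rfl) (ih _)).mono
      (by simp only [List.length_cons]; omega)
  | nil =>
    induction l generalizing s with
    | cons x l ih =>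
      exact (EvalsIn.head (step_eq (l' := some .clear) (v' := s.set (some x))
        (S' := stk [] l h c [] o) rfl rfl fun k => by cases k <;> rfl) (ih _)).mono
        (by simp only [List.length_cons]; omega)
    | nil =>
      induction h generalizing s with
      | cons x h ih =>
        exact (EvalsIn.head (step_eq (l' := some .clear) (v' := s.set (some x))
          (S' := stk [] [] h c [] o) rfl rfl fun k => by cases k <;> rfl) (ih _)).mono
          (by simp only [List.length_cons]; omega)
      | nil =>
        induction c generalizing s with
        | cons x c ih =>
          exact (EvalsIn.head (step_eq (l' := some .clear) (v' := s.set (some x))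
            (S' := stk [] [] [] c [] o) rfl rfl fun k => by cases k <;> rfl) (ih _)).mono
            (by simp only [List.length_cons]; omega)
        | nil => exact .single (step_eq rfl rfl fun k => by cases k <;> rfl)

theorem evalsIn_pad (s : Reg) (i : List I) (l t : List Bool) :
    EvalsIn (TM2.step (prog rd)) ⟨some .pad, s, stk i l [] [] t []⟩
      ⟨some .next, s.set none, stk i (List.replicate t.length false ++ l) [] [] [] []⟩
      (t.length + 1) := by
  induction t generalizing s l with
  | nil => exact .single (step_eq rfl rfl fun k => by cases k <;> rfl)
  | cons x t ih =>
    refine .head (step_eq (l' := some .pad) (v' := s.set (some x))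
      (S' := stk i (false :: l) [] [] t []) rfl rfl fun k => by cases k <;> rfl) ?_
    simpa [List.replicate_succ', Reg.set] using ih (s.set (some x)) (false :: l)

/-- The word of an inequality: `a` coefficients `0`, one coefficient `1`, the coefficients `h`, and
the right-hand side `c` in binary. -/
def ineqWord (a : ℕ) (h c : List Bool) : List Γ' :=
  List.replicate a Γ'.comma ++
    (Γ'.bit true :: Γ'.comma :: (h.flatMap coeffWord ++ (c.map Γ'.bit ++ [Γ'.ket])))

theorem evalsIn_next_true (s : Reg) (i : List I) (l h c : List Bool) (o : List Γ') :
    EvalsIn (TM2.step (prog rd)) ⟨some .next, s, stk i (true :: l) h c [] o⟩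
      ⟨some .next, ⟨none, true, false⟩, stk i l (true :: h) (addCarry c true) [] o⟩
      (2 * c.length + 4) := by
  have h1 := evalsIn_cntFwd rd (some true) true true i l h c [] o
  simp only [List.append_nil] at h1
  have h2 := evalsIn_cntBack_true rd none false i l h [] (addCarry c true).reverse o
  simp only [List.append_nil, List.reverse_reverse, List.length_reverse] at h2
  refine (EvalsIn.head (step_eq (l' := some .cntFwd) (v' := ⟨some true, true, true⟩)
    (S' := stk i l h c [] o) rfl rfl fun k => by cases k <;> rfl) (h1.trans h2)).mono ?_
  have := length_addCarry_le c true
  omega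

theorem evalsIn_next_false (s : Reg) (i : List I) (l h c : List Bool) (o : List Γ') :
    EvalsIn (TM2.step (prog rd)) ⟨some .next, s, stk i (false :: l) h c [] o⟩
      ⟨some .next, ⟨none, false, false⟩,
        stk i l (false :: h) c [] (ineqWord l.length h c ++ o)⟩
      (2 * (c.length + h.length + l.length) + 7) := by
  have h1 := evalsIn_cntFwd rd (some false) false false i l h c [] (Γ'.ket :: o)
  simp only [addCarry_false, List.append_nil] at h1
  have h2 := evalsIn_cntBack_false rd none false i l h [] c.reverse (Γ'.ket :: o)
  simp only [List.append_nil, List.reverse_reverse, List.length_reverse] at h2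
  have h3 := evalsIn_highFwd rd none false false i l h c [] (c.map Γ'.bit ++ Γ'.ket :: o)
  simp only [List.append_nil] at h3
  have h4 := evalsIn_highBack rd none false false i l [] c h.reverse
    (c.map Γ'.bit ++ Γ'.ket :: o)
  simp only [List.append_nil, List.reverse_reverse, List.length_reverse] at h4
  have h5 := evalsIn_lowFwd rd none false false i l h c []
    (Γ'.bit true :: Γ'.comma :: (h.flatMap coeffWord ++ (c.map Γ'.bit ++ Γ'.ket :: o)))
  simp only [List.append_nil] at h5
  have h6 := evalsIn_lowBack rd none false false i [] h c l.reverse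
    (ineqWord l.length h c ++ o)
  simp only [List.append_nil, List.reverse_reverse, List.length_reverse] at h6
  have h5' : List.replicate l.length Γ'.comma ++ (Γ'.bit true :: Γ'.comma ::
      (h.flatMap coeffWord ++ (c.map Γ'.bit ++ Γ'.ket :: o))) = ineqWord l.length h c ++ o := by
    simp [ineqWord]
  rw [h5'] at h5
  refine (EvalsIn.head (step_eq (l' := some .cntFwd) (v' := ⟨some false, false, false⟩)
    (S' := stk i l h c [] (Γ'.ket :: o)) rfl rfl fun k => by cases k <;> rfl)
    (h1.trans (h2.trans (h3.trans (h4.trans (h5.trans h6)))))).mono ?_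
  omega

/-- The output produced from the digits `l` to be processed, the processed digits `h`, and the
number `c` of ones among the latter, in front of the output `o` produced so far. -/
def emit : List Bool → List Bool → List Bool → List Γ' → List Γ'
  | [], _, _, o => o
  | true :: l, h, c, o => emit l (true :: h) (addCarry c true) o
  | false :: l, h, c, o => emit l (false :: h) c (ineqWord l.length h c ++ o)

/-- The count never has more binary digits than there are processed digits, so one digit costs at
most `4 * N + 7` steps; the final clearing costs at most `2 * N + 2`. -/
theorem evalsIn_next {N : ℕ} (s : Reg) (l h c : List Bool) (o : List Γ')
    (hc : c.length ≤ h.length) (hN : h.length + l.length ≤ N) :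
    EvalsIn (TM2.step (prog rd)) ⟨some .next, s, stk [] l h c [] o⟩
      ⟨none, Reg.init, stk [] [] [] [] [] (emit l h c o)⟩
      (l.length * (4 * N + 7) + 2 * N + 2) := by
  induction l generalizing s h c o with
  | nil =>
    refine (EvalsIn.head (step_eq (l' := some .clear) (v' := ⟨none, false, false⟩)
      (S' := stk [] [] h c [] o) rfl rfl fun k => by cases k <;> rfl)
      (evalsIn_clear rd _ [] [] h c o)).mono ?_
    simp only [List.length_nil] at hN ⊢
    omega
  | cons x l ih =>
    simp only [List.length_cons] at hN ⊢
    cases x with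
    | false =>
      refine ((evalsIn_next_false rd s [] l h c o).trans (ih _ (false :: h) c _ ?_ ?_)).mono ?_
      · simp only [List.length_cons]; omega
      · simp only [List.length_cons]; omega
      · rw [add_mul, one_mul]; omega
    | true =>
      have := length_addCarry_le c true
      refine ((evalsIn_next_true rd s [] l h c o).trans (ih _ (true :: h) _ _ ?_ ?_)).mono ?_
      · simp only [List.length_cons]; omega
      · simp only [List.length_cons]; omega
      · rw [add_mul, one_mul]; omega

end CoverMachine

/-! ### Encodings as lists of binary digits. -/

theorem encodePosNum_eq_bits (p : PosNum) : encodePosNum p = (p : ℕ).bits := by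
  induction p with
  | one => simp [encodePosNum]
  | bit1 p ih => rw [encodePosNum, ih, PosNum.cast_bit1, ← two_mul, Nat.bit1_bits]
  | bit0 p ih =>
    rw [encodePosNum, ih, PosNum.cast_bit0, ← two_mul, Nat.bit0_bits _ (PosNum.cast_pos p).ne']

theorem encodeNat_eq_bits (n : ℕ) : encodeNat n = n.bits := by
  have h : ∀ m : Num, encodeNum m = (m : ℕ).bits := by
    rintro (_ | p)
    · rfl
    · exact encodePosNum_eq_bits p
  rw [encodeNat, h, Num.to_of_nat]

theorem map_testBit_range (b n : ℕ) (h : b.size ≤ n) :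
    (List.range n).map b.testBit = b.bits ++ List.replicate (n - b.size) false := by
  refine List.ext_getElem (by simp [Nat.size_eq_bits_len]; omega) fun i h1 h2 => ?_
  rw [List.getElem_map, List.getElem_range, Nat.testBit_eq_inth, List.getElem_append]
  split_ifs with hi
  · exact List.getI_eq_getElem _ hi
  · rw [List.getElem_replicate]
    exact List.getI_eq_default _ (not_lt.1 hi)

theorem logDim_eq_size (u : ℕ) : logDim u = u.size := by
  refine le_antisymm ((Nat.clog_le_iff_le_pow one_lt_two).2 (Nat.lt_size_self u)) ?_
  exact Nat.size_le.2 ((Nat.clog_le_iff_le_pow one_lt_two).1 le_rfl)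

theorem unaryEncodeNat_eq_replicate (n : ℕ) : unaryEncodeNat n = List.replicate n true := by
  induction n with
  | zero => rfl
  | succ n ih => rw [unaryEncodeNat, ih, List.replicate_succ]

/-! ### Correctness of the output, and the reading phases. -/

namespace CoverMachine

theorem addCarry_bits_true (n : ℕ) : addCarry n.bits true = (n + 1).bits := by
  induction n using Nat.strong_induction_on with
  | _ n ih =>
    rcases Nat.even_or_odd' n with ⟨m, rfl | rfl⟩
    · rcases eq_or_ne m 0 with rfl | hm
      · simp [addCarry]
      · rw [Nat.bit0_bits m hm, Nat.bit1_bits]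
        simp [addCarry, addCarry_false]
    · rw [Nat.bit1_bits, show 2 * m + 1 + 1 = 2 * (m + 1) by ring,
        Nat.bit0_bits _ m.succ_ne_zero, ← ih m (by omega)]
      simp [addCarry]

/-- The binary digits of `b` at the positions `i, …, n - 1`. -/
def highDigits (b n i : ℕ) : List Bool := (List.range' i (n - i)).map b.testBit

theorem highDigits_eq_cons {b n i : ℕ} (h : i < n) :
    highDigits b n i = b.testBit i :: highDigits b n (i + 1) := by
  rw [highDigits, show n - i = (n - (i + 1)) + 1 by omega, List.range'_succ, List.map_cons]
  rfl

theorem map_coverCoeff_range {b n j : ℕ} (h : j < n) : (List.range n).map (coverCoeff b j) =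
    List.replicate j 0 ++ 1 :: (highDigits b n (j + 1)).map Bool.toNat := by
  have h1 : List.range n = List.range j ++ j :: List.range' (j + 1) (n - (j + 1)) := by
    conv_lhs => rw [show n = j + ((n - (j + 1)) + 1) by omega]
    rw [List.range_eq_range', ← List.range'_append_1, List.range'_succ, zero_add,
      ← List.range_eq_range']
  rw [h1, List.map_append, List.map_cons, coverCoeff_self, highDigits, List.map_map]
  congr 1
  · refine List.eq_replicate_iff.2 ⟨by simp, fun k hk => ?_⟩
    obtain ⟨i, hi, rfl⟩ := List.mem_map.1 hk
    exact coverCoeff_of_lt b (List.mem_range.1 hi)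
  · congr 1
    refine List.map_congr_left fun k hk => ?_
    exact coverCoeff_of_gt b (List.mem_range'_1.1 hk).1

theorem sum_map_toNat (l : List Bool) : (l.map Bool.toNat).sum = l.count true := by
  induction l with
  | nil => rfl
  | cons x l ih => cases x <;> simp [ih, add_comm]

/-- The coefficient 1 at `j` cancels the `- 1`, leaving the ones of `b` above `j`. -/
theorem coverIneq_rhs {b n j : ℕ} (h : j < n) :
    (coverIneq n b j).rhs = (highDigits b n (j + 1)).count true := by
  have h1 : ∑ k ∈ Finset.range n, coverCoeff b j k = ((List.range n).map (coverCoeff b j)).sum :=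
    rfl
  rw [coverIneq, h1, map_coverCoeff_range h]
  simp [sum_map_toNat]

theorem flatMap_coeffWord (l : List Bool) :
    (l.map Bool.toNat).flatMap (fun c => (encodeNat c).map Γ'.bit ++ [Γ'.comma]) =
      l.flatMap coeffWord := by
  induction l with
  | nil => rfl
  | cons x l ih =>
    rw [List.map_cons, List.flatMap_cons, List.flatMap_cons, ih]
    cases x <;> rfl

/-- Zero is encoded by the empty word, so each leading zero coefficient is a bare comma. -/
theorem toWord_coverIneq {b n j : ℕ} (h : j < n) : (coverIneq n b j).toWord =
    ineqWord j (highDigits b n (j + 1)) ((highDigits b n (j + 1)).count true).bits := by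
  rw [NatIneq.toWord, coverIneq_rhs h, encodeNat_eq_bits]
  have h0 : (List.replicate j 0).flatMap (fun c => (encodeNat c).map Γ'.bit ++ [Γ'.comma]) =
      List.replicate j Γ'.comma := by
    induction j with
    | zero => rfl
    | succ j ih => rw [List.replicate_succ, List.flatMap_cons, ih (by omega)]; rfl
  have h1 : (encodeNat 1).map Γ'.bit = [Γ'.bit true] := rfl
  simp only [coverIneq, map_coverCoeff_range h, List.flatMap_append, List.flatMap_cons, h0, h1,
    flatMap_coeffWord, ineqWord, List.append_assoc, List.cons_append, List.nil_append]

/-- Loop invariant: with `i` digits left, the processed ones are those at `i, …, n - 1`. Words are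
prepended as the index falls, so they end up in increasing order. -/
theorem emit_digits {b n i : ℕ} (h : i ≤ n) (o : List Γ') :
    emit ((List.range i).map b.testBit).reverse (highDigits b n i)
        ((highDigits b n i).count true).bits o =
      (((List.range i).filter fun j => !b.testBit j).map (coverIneq n b)).flatMap NatIneq.toWord
        ++ o := by
  induction i generalizing o with
  | zero => rfl
  | succ i ih =>
    have hi := ih (by omega)
    rw [highDigits_eq_cons (show i < n by omega)] at hi
    rw [List.range_succ, List.map_append, List.reverse_append, List.filter_append]
    cases hb : b.testBit i with
    | true =>
      rw [hb, List.count_cons_self, ← addCarry_bits_true] at hi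
      simpa [emit, hb] using hi o
    | false =>
      rw [hb, List.count_cons_of_ne (by decide)] at hi
      simp only [List.map_cons, List.map_nil, hb, List.reverse_cons, List.reverse_nil,
        List.nil_append, List.cons_append, emit]
      rw [hi]
      simp [hb, toWord_coverIneq (show i < n by omega)]

theorem emit_eq_encode {n b : ℕ} (hb : b < 2 ^ n) :
    emit ((List.range n).map b.testBit).reverse [] [] [] =
      NatIneq.encodingSystem.encode (coverSystem n b) := by
  have h := emit_digits (b := b) (le_refl n) []
  simp only [highDigits, Nat.sub_self, List.range'_zero, List.map_nil, List.count_nil,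
    Nat.zero_bits, List.append_nil] at h
  rw [h, coverSystem, if_neg (not_le.2 hb)]
  rfl

/-- The machine with a given statement for reading an input symbol. -/
def machine {I : Type} [Fintype I] (rd : Stm I) : FinTM2 where
  K := Stack
  k₀ := .inp
  k₁ := .out
  Γ := Alph I
  Λ := Label
  main := .read
  σ := Reg
  initialState := Reg.init
  Γk₀Fin := inferInstanceAs (Fintype I)
  m := prog rd

/-- To show that the machine computes a function it suffices to bound its running time by
`20 * (m + 1) ^ 2`, where `m` is the length of the input. -/
theorem isPolyTime_of_evalsIn {I α β : Type} [Fintype I] (rd : Stm I) (ea : Encoding α I)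
    (eb : Encoding β Γ') (f : α → β)
    (h : ∀ a, EvalsIn (TM2.step (prog rd))
      ⟨some .read, Reg.init, stk (ea.encode a) [] [] [] [] []⟩
      ⟨none, Reg.init, stk [] [] [] [] [] (eb.encode (f a))⟩
      (20 * ((ea.encode a).length + 1) ^ 2)) : IsPolyTime ea eb f := by
  refine ⟨{ tm := machine rd, inputAlphabet := Equiv.refl _, outputAlphabet := Equiv.refl _,
            time := 20 * (Polynomial.X + 1) ^ 2, outputsFun := fun a => Classical.choice ?_ }⟩
  have h1 : initList (machine rd) ((ea.encode a).map (Equiv.refl I).invFun) =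
      (⟨some .read, Reg.init, stk (ea.encode a) [] [] [] [] []⟩ : Conf I) :=
    (congrArg (initList (machine rd)) (List.map_id (ea.encode a))).trans
      (congrArg (TM2.Cfg.mk (some Label.read) Reg.init) (funext fun k => by cases k <;> rfl))
  have h2 : haltList (machine rd) ((eb.encode (f a)).map (Equiv.refl Γ').invFun) =
      (⟨none, Reg.init, stk [] [] [] [] [] (eb.encode (f a))⟩ : Conf I) :=
    (congrArg (haltList (machine rd)) (List.map_id (eb.encode (f a)))).trans
      (congrArg (TM2.Cfg.mk none Reg.init) (funext fun k => by cases k <;> rfl))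
  have h3 : (20 * (Polynomial.X + 1) ^ 2 : Polynomial ℕ).eval (ea.encode a).length =
      20 * ((ea.encode a).length + 1) ^ 2 := by simp
  have := h a
  rw [← h1, ← h2, ← h3] at this
  exact this

open TM2.Stmt in
/-- Read the binary digits of a number, least significant digit first. -/
def readNat : Stm Bool :=
  pop .inp Reg.set <| branch (fun s => s.cur.isNone) (goto fun _ => .next) <|
    push .low Reg.val <| goto fun _ => .read

theorem evalsIn_readNat (s : Reg) (i l : List Bool) :
    EvalsIn (TM2.step (prog readNat)) ⟨some .read, s, stk i l [] [] [] []⟩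
      ⟨some .next, s.set none, stk [] (i.reverse ++ l) [] [] [] []⟩ (i.length + 1) := by
  induction i generalizing s l with
  | nil => exact .single (step_eq rfl rfl fun k => by cases k <;> rfl)
  | cons x i ih =>
    refine .head (step_eq (l' := some .read) (v' := s.set (some x))
      (S' := stk i (x :: l) [] [] [] []) rfl rfl fun k => by cases k <;> rfl) ?_
    simpa [Reg.set] using ih (s.set (some x)) (x :: l)

open TM2.Stmt in
/-- Read a number in unary and then the binary digits of a second number; give up if there are more
digits than marks. -/
def readInstance : Stm (Bool ⊕ Bool) :=
  pop .inp (fun s x => ⟨x.map (Sum.elim id id), (x.map Sum.isLeft).getD false, s.carry⟩) <|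
  branch (fun s => s.cur.isNone) (goto fun _ => .pad) <|
  branch Reg.digit (push .tmp (fun _ => true) <| goto fun _ => .read) <|
  pop .tmp (fun s x => ⟨s.cur, x.isNone, s.carry⟩) <|
  branch Reg.digit (goto fun _ => .clear) <|
  push .low Reg.val <| goto fun _ => .read

theorem evalsIn_readInstance_marks (s : Reg) (i : List (Bool ⊕ Bool)) (n : ℕ) (t : List Bool) :
    ∃ s', EvalsIn (TM2.step (prog readInstance))
      ⟨some .read, s, stk (List.replicate n (Sum.inl true) ++ i) [] [] [] t []⟩
      ⟨some .read, s', stk i [] [] [] (List.replicate n true ++ t) []⟩ n := by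
  induction n generalizing s t with
  | zero => exact ⟨s, ⟨EvalsToInTime.refl _ _⟩⟩
  | succ n ih =>
    obtain ⟨s', h⟩ := ih ⟨some true, true, s.carry⟩ (true :: t)
    refine ⟨s', .head (step_eq (l' := some .read) (v' := ⟨some true, true, s.carry⟩)
      (S' := stk (List.replicate n (Sum.inl true) ++ i) [] [] [] (true :: t) []) rfl rfl
      fun k => by cases k <;> rfl) ?_⟩
    simpa [List.replicate_succ'] using h

/-- Each digit consumes a mark; the marks left over count the missing leading zeros, which the
padding loop supplies. -/
theorem evalsIn_readInstance_digits (s : Reg) (d l t : List Bool) (h : d.length ≤ t.length) :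
    ∃ s', EvalsIn (TM2.step (prog readInstance))
      ⟨some .read, s, stk (d.map Sum.inr) l [] [] t []⟩
      ⟨some .pad, s', stk [] (d.reverse ++ l) [] [] (t.drop d.length) []⟩ (d.length + 1) := by
  induction d generalizing s l t with
  | nil => exact ⟨⟨none, false, s.carry⟩, .single (step_eq rfl rfl fun k => by cases k <;> rfl)⟩
  | cons x d ih =>
    obtain _ | ⟨y, t⟩ := t
    · simp at h
    obtain ⟨s', h⟩ := ih ⟨some x, false, s.carry⟩ (x :: l) t (by simpa using h)
    refine ⟨s', .head (step_eq (l' := some .read) (v' := ⟨some x, false, s.carry⟩)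
      (S' := stk (d.map Sum.inr) (x :: l) [] [] t []) rfl rfl fun k => by cases k <;> rfl) ?_⟩
    simpa using h

theorem evalsIn_readInstance_overflow (s : Reg) (d l t : List Bool) (h : t.length < d.length) :
    EvalsIn (TM2.step (prog readInstance))
      ⟨some .read, s, stk (d.map Sum.inr) l [] [] t []⟩
      ⟨none, Reg.init, stk [] [] [] [] [] []⟩ (d.length + l.length + d.length + 1) := by
  induction d generalizing s l t with
  | nil => simp at h
  | cons x d ih =>
    obtain _ | ⟨y, t⟩ := t
    · refine (EvalsIn.head (step_eq (l' := some .clear) (v' := ⟨some x, true, s.carry⟩)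
        (S' := stk (d.map Sum.inr) l [] [] [] []) rfl rfl fun k => by cases k <;> rfl)
        (evalsIn_clear _ _ _ l [] [] [])).mono ?_
      simp only [List.length_cons, List.length_map, List.length_nil]
      omega
    · refine (EvalsIn.head (step_eq (l' := some .read) (v' := ⟨some x, false, s.carry⟩)
        (S' := stk (d.map Sum.inr) (x :: l) [] [] t []) rfl rfl fun k => by cases k <;> rfl)
        (ih _ (x :: l) t (by simpa using h))).mono ?_
      simp only [List.length_cons]
      omega

/-! ### Polynomial-time computability. -/

theorem isPolyTime_coverSystem_logDim : IsPolyTime encodingNatBool NatIneq.encodingSystem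
    (fun u : ℕ => coverSystem (logDim u) u) := by
  refine isPolyTime_of_evalsIn readNat _ _ _ fun u => ?_
  have h0 : encodingNatBool.encode u = u.bits := encodeNat_eq_bits u
  have h1 := evalsIn_readNat Reg.init u.bits []
  have h2 := evalsIn_next (N := u.size) readNat (Reg.init.set none)
    ((List.range u.size).map u.testBit).reverse [] [] [] le_rfl (by simp)
  rw [emit_eq_encode (Nat.lt_size_self u)] at h2
  -- Here the dimension is exactly the number of digits, so no padding is needed.
  have h3 : (List.range u.size).map u.testBit = u.bits := by
    simp [map_testBit_range u u.size le_rfl]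
  rw [h3] at h2
  rw [List.append_nil] at h1
  rw [h0, logDim_eq_size]
  refine (h1.trans h2).mono ?_
  rw [List.length_reverse, Nat.size_eq_bits_len]
  nlinarith

theorem isPolyTime_coverSystem : IsPolyTime encodingInstance NatIneq.encodingSystem
    (fun p : ℕ × ℕ => coverSystem p.1 p.2) := by
  refine isPolyTime_of_evalsIn readInstance _ _ _ fun ⟨n, b⟩ => ?_
  have h0 : encodingInstance.encode (n, b) =
      List.replicate n (Sum.inl true) ++ b.bits.map Sum.inr := by
    change (unaryEncodeNat n).map Sum.inl ++ (encodeNat b).map Sum.inr = _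
    rw [encodeNat_eq_bits, unaryEncodeNat_eq_replicate, List.map_replicate]
  rw [h0]
  simp only [List.length_append, List.length_replicate, List.length_map]
  obtain ⟨s, h1⟩ := evalsIn_readInstance_marks Reg.init (b.bits.map Sum.inr) n []
  rw [List.append_nil] at h1
  rcases lt_or_ge b (2 ^ n) with hb | hb
  · have hs : b.bits.length ≤ n := by
      rw [Nat.size_eq_bits_len]
      exact Nat.size_le.2 hb
    obtain ⟨s', h2⟩ := evalsIn_readInstance_digits s b.bits [] (List.replicate n true)
      (by simpa using hs)
    rw [List.append_nil, List.drop_replicate] at h2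
    have h3 := evalsIn_pad readInstance s' [] b.bits.reverse
      (List.replicate (n - b.bits.length) true)
    rw [List.length_replicate] at h3
    have h4 := evalsIn_next (N := n) readInstance (s'.set none)
      ((List.range n).map b.testBit).reverse [] [] [] le_rfl (by simp)
    rw [emit_eq_encode hb] at h4
    have h5 : ((List.range n).map b.testBit).reverse =
        List.replicate (n - b.bits.length) false ++ b.bits.reverse := by
      rw [map_testBit_range b n (Nat.size_le.2 hb), List.reverse_append, List.reverse_replicate,
        Nat.size_eq_bits_len]
    have h6 : (List.replicate (n - b.bits.length) false ++ b.bits.reverse).length = n := by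
      simp [hs]
    rw [h5, h6] at h4
    refine (h1.trans (h2.trans (h3.trans h4))).mono ?_
    have := Nat.sub_le n b.bits.length
    nlinarith
  -- `Nat.bits` has no leading zeros, so the marks run out exactly when `2 ^ n ≤ b`, and the correct
  -- output is empty.
  · have hs : n < b.bits.length := by
      rw [Nat.size_eq_bits_len]
      exact Nat.lt_size.2 hb
    have h2 := evalsIn_readInstance_overflow s b.bits [] (List.replicate n true) (by simpa using hs)
    have h3 : NatIneq.encodingSystem.encode (coverSystem n b) = [] := by
      rw [coverSystem, if_pos hb]
      rfl
    rw [h3]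
    refine (h1.trans h2).mono ?_
    rw [List.length_nil]
    nlinarith

end CoverMachine

theorem mainTheorem12 :
    -- the knapsack polytope is described by the bounds and at most `n - 1` cover inequalities
    (∀ n b : ℕ, 0 < n → 0 < b →
      knapsackPolytope n b =
          {x | (∀ i, 0 ≤ x i ∧ x i ≤ 1) ∧ ∀ r ∈ coverSystem n b, r.HoldsAt x} ∧
        (∀ r ∈ coverSystem n b, IsCoverIneq n b r) ∧
        (coverSystem n b).length ≤ n - 1) ∧
    -- these inequalities are computable in polynomial time
    IsPolyTime encodingInstance NatIneq.encodingSystem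
      (fun p : ℕ × ℕ => coverSystem p.1 p.2) ∧
    -- one equation, the bounds on `z` and at most `q - 1` inequalities in `z` describe the
    -- perfect logarithmic binarization
    (∀ u : ℕ, 0 < u →
      perfectLogBinarization u =
          {p | p.1 = ∑ j : Fin (logDim u), (2 : ℝ) ^ (j : ℕ) * p.2 j ∧
            (∀ j, 0 ≤ p.2 j ∧ p.2 j ≤ 1) ∧
            ∀ r ∈ coverSystem (logDim u) u, r.HoldsAt p.2} ∧
        (coverSystem (logDim u) u).length ≤ logDim u - 1) ∧
    -- these inequalities are computable in polynomial time
    IsPolyTime encodingNatBool NatIneq.encodingSystem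
      (fun u : ℕ => coverSystem (logDim u) u) := by
  refine ⟨fun n b _ hb => ⟨knapsackPolytope_eq n b, fun r hr => isCoverIneq_of_mem_coverSystem hr,
    length_coverSystem_le hb⟩, CoverMachine.isPolyTime_coverSystem, fun u hu =>
    ⟨perfectLogBinarization_eq u, length_coverSystem_le hu⟩,
    CoverMachine.isPolyTime_coverSystem_logDim⟩
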